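/- All graphs are finite and simple. A path in an edge-coloured graph is \emph{proper} if no two adjacent edges of it have the same colour. For a connected graph $G$, the proper connection number $pc(G)$ is the minimum number of colours in an edge-colouring of $G$ for which every two distinct vertices are joined by a proper path. Let $G$ be a connected bipartite graph of order $n\ge 4$. If $d(x)+d(y)\ge \frac{n+6}{4}$ for every pair of distinct nonadjacent vertices $x,y\in V(G)$, then $pc(G)=2$. The bound is best possible in the following sense. Let $H$ be the graph of order $n=19$ obtained from three disjoint copies $G_1,G_2,G_3$ of $K_{3,3}$ and a further vertex $v_0$ by choosing a vertex $v_i\in V(G_i)$ and joining $v_0$ to $v_i$, for $i=1,2,3$. Then $H$ is connected and bipartite, and $d(x)+d(y)\ge \frac n4+1$ for every pair of distinct nonadjacent vertices $x,y$ of $H$, but $pc(H)=3$. Moreover, the first assertion becomes false if $\frac{n+6}{4}$ is replaced by $\frac{n+5}{4}$. -/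

import Mathlib

universe u

namespace ProperConnection

/-- A proper path in the edge-coloured graph `(G, c)`: a path on which no two consecutive edges
receive the same colour. -/
def IsProperPath {V : Type u} {G : SimpleGraph V} {α : Type} (c : G.edgeSet → α)
    {x y : V} (p : G.Walk x y) : Prop :=
  p.IsPath ∧ (p.darts.map fun d => c ⟨d.edge, d.edge_mem⟩).IsChain (· ≠ ·)

/-- The edge-coloured graph `(G, c)` is proper connected: any two distinct vertices are joined by
a proper path. -/
def IsProperConnected {V : Type u} (G : SimpleGraph V) {α : Type} (c : G.edgeSet → α) : Prop :=
  ∀ x y : V, x ≠ y → ∃ p : G.Walk x y, IsProperPath c p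

/-- The proper connection number: the least number of colours in an edge-colouring that makes `G`
proper connected. (It is meant for finite connected graphs, where such colourings exist.) -/
noncomputable def pc {V : Type u} (G : SimpleGraph V) : ℕ :=
  sInf {k : ℕ | ∃ c : G.edgeSet → Fin k, IsProperConnected G c}

/-- Adjacency of `exampleGraph`. -/
def exampleAdj : Option (Fin 3 × Bool × Fin 3) → Option (Fin 3 × Bool × Fin 3) → Prop
  | none, none => False
  | none, some (_, b, j) => b = false ∧ j = 0
  | some (_, b, j), none => b = false ∧ j = 0
  | some (i, b, _), some (i', b', _) => i = i' ∧ b ≠ b'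

/-- Three disjoint copies of `K_{3,3}` (the `i`-th has the vertices `some (i, b, j)`, where `b`
tells the part) and one more vertex `none`, joined to the vertex `some (i, false, 0)` of each
copy. -/
def exampleGraph : SimpleGraph (Option (Fin 3 × Bool × Fin 3)) where
  Adj := exampleAdj
  symm := ⟨by
    rintro (_ | ⟨i, b, j⟩) (_ | ⟨i', b', j'⟩) h
    · exact h
    · exact h
    · exact h
    · exact ⟨h.1.symm, h.2.symm⟩⟩
  loopless := ⟨by
    rintro (_ | ⟨i, b, j⟩) h
    · exact h
    · exact h.2 rfl⟩

instance : DecidableRel exampleGraph.Adj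
  | none, none => inferInstanceAs (Decidable False)
  | none, some (_, b, j) => inferInstanceAs (Decidable (b = false ∧ j = 0))
  | some (_, b, j), none => inferInstanceAs (Decidable (b = false ∧ j = 0))
  | some (i, b, _), some (i', b', _) => inferInstanceAs (Decidable (i = i' ∧ b ≠ b'))

end ProperConnection

namespace ProperConnection

open Relation SimpleGraph

/-! ### Strongly connected orientation away from the bridges -/

section Orientation

variable {V : Type u} {G : SimpleGraph V}

/-! Orient the graph and colour each arc by the part containing its tail. In a bipartite graph,
consecutive tails on a directed path lie in different parts, so directed paths are proper. Two
colours therefore suffice once any two vertices are joined by a directed path one way or the other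
(`exists_isProperConnected_of_orientation`).

Such an orientation exists if there are no three pairwise disjoint bridge sides, that is, if
contracting the bridgeless components leaves a path: orient these components strongly by adding
ears, and all bridges along the path (`exists_unilateral_orientation`). Three disjoint sides are
impossible by counting: the degree condition makes each side so large that too little is left
between them (`not_hasThreeCuts_of_degree_sum`).

In the example, a proper path between two copies uses their two bridges consecutively, so the three
bridges need three colours. -/

theorem reflTransGen_of_walk {r : V → V → Prop} {x y : V} (p : G.Walk x y)
    (h : ∀ d ∈ p.darts, ReflTransGen r d.fst d.snd) :
    ReflTransGen r x y ∧
      ∀ d ∈ p.darts, ReflTransGen r x d.fst ∧ ReflTransGen r d.snd y := by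
  induction p with
  | nil => exact ⟨.refl, by simp⟩
  | cons hadj p ih =>
    simp only [Walk.darts_cons, List.mem_cons, forall_eq_or_imp] at h ⊢
    obtain ⟨h₁, h₂⟩ := ih h.2
    exact ⟨h.1.trans h₁, ⟨.refl, h₁⟩, fun d hd => ⟨h.1.trans (h₂ d hd).1, (h₂ d hd).2⟩⟩

/-- A partial orientation of `G` all of whose arcs lie on closed directed walks. -/
structure IsCyclicOrientation (G : SimpleGraph V) (D : V → V → Prop) : Prop where
  adj : ∀ u v, D u v → G.Adj u v
  asymm : ∀ u v, D u v → ¬ D v u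
  back : ∀ u v, D u v → ReflTransGen D v u

theorem IsCyclicOrientation.symm {D : V → V → Prop} (hD : IsCyclicOrientation G D) {x y : V}
    (h : ReflTransGen D x y) : ReflTransGen D y x := by
  induction h with
  | refl => exact .refl
  | tail _ h ih => exact (hD.back _ _ h).trans ih

/-- Adding an ear: an edge `uw` that is not a bridge can be brought into a cyclic orientation. -/
theorem IsCyclicOrientation.exists_extension {D : V → V → Prop} (hD : IsCyclicOrientation G D)
    {u w : V} (huw : G.Adj u w) (hn : ¬ ReflTransGen D u w)
    (hr : (G.deleteEdges {s(u, w)}).Reachable w u) :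
    ∃ D', IsCyclicOrientation G D' ∧ D ≤ D' ∧ D' u w := by
  obtain ⟨p, hp⟩ := hr.exists_isPath
  -- Only the ear's darts not already bridged by a `D`-walk become arcs. This keeps `D'` asymmetric,
  -- as a reverse arc in `D` would supply such a walk.
  let D' : V → V → Prop := fun a b => D a b ∨ (a = u ∧ b = w) ∨
    ∃ d ∈ p.darts, d.fst = a ∧ d.snd = b ∧ ¬ ReflTransGen D a b
  have hle : D ≤ D' := fun a b h => Or.inl h
  have hmono : ∀ {a b}, ReflTransGen D a b → ReflTransGen D' a b :=
    fun h => ReflTransGen.mono hle _ _ h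
  have hdart : ∀ d ∈ p.darts, ReflTransGen D' d.fst d.snd := by
    intro d hd
    by_cases h : ReflTransGen D d.fst d.snd
    · exact hmono h
    · exact .single (Or.inr (Or.inr ⟨d, hd, rfl, rfl, h⟩))
  obtain ⟨hwu, hends⟩ := reflTransGen_of_walk p hdart
  have huw' : D' u w := Or.inr (Or.inl ⟨rfl, rfl⟩)
  refine ⟨D', ⟨?_, ?_, ?_⟩, hle, huw'⟩
  · rintro a b (h | ⟨rfl, rfl⟩ | ⟨d, -, rfl, rfl, -⟩)
    · exact hD.adj _ _ h
    · exact huw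
    · exact (deleteEdges_adj.1 d.adj).1
  · rintro a b (h | ⟨rfl, rfl⟩ | ⟨d, hd, rfl, rfl, hnd⟩) (h' | ⟨h₁, h₂⟩ | ⟨d', hd', h₁, h₂, hnd'⟩)
    · exact hD.asymm _ _ h h'
    · subst h₁ h₂
      exact hn (hD.back _ _ h)
    · exact hnd' (hD.back _ _ h)
    · exact hn (hD.back _ _ h')
    · exact huw.ne h₂
    · have := (deleteEdges_adj.1 d'.adj).2
      rw [h₁, h₂] at this
      exact this (by simp [Sym2.eq_swap])
    · exact hnd (hD.back _ _ h')
    · have := (deleteEdges_adj.1 d.adj).2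
      rw [h₁, h₂] at this
      exact this (by simp [Sym2.eq_swap])
    · have heq : d.edge = d'.edge :=
        (dart_edge_eq_iff d d').2 (Or.inr (Dart.ext _ _ (Prod.ext h₂.symm h₁.symm)))
      have hdd : d = d' := List.inj_on_of_nodup_map hp.isTrail.edges_nodup hd hd' heq
      subst hdd
      exact d.adj.ne h₁
  · rintro a b (h | ⟨rfl, rfl⟩ | ⟨d, hd, rfl, rfl, -⟩)
    · exact hmono (hD.back _ _ h)
    · exact hwu
    · exact ((hends d hd).2.tail huw').trans (hends d hd).1

/-- A finite graph has an orientation making every bridgeless component strongly connected. -/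
theorem exists_cyclicOrientation [Finite V] (G : SimpleGraph V) :
    ∃ D, IsCyclicOrientation G D ∧ ∀ u w, G.Adj u w → ¬ ReflTransGen D u w →
      ¬ (G.deleteEdges {s(u, w)}).Reachable w u := by
  obtain ⟨D, hD⟩ := (Set.toFinite {D | IsCyclicOrientation G D}).exists_maximal
    ⟨fun _ _ => False, by constructor <;> simp⟩
  refine ⟨D, hD.prop, fun u w huw hn hr => ?_⟩
  obtain ⟨D', hD', hle, h⟩ := hD.prop.exists_extension huw hn hr
  exact hn (.single (hD.le_of_ge hD' hle u w h))

/-! ### Bridge cuts and the unilateral orientation -/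

/-- `G.Adj a b` is the only edge between `T` and its complement, and it enters `T` at `b`. -/
structure IsCut (G : SimpleGraph V) (a b : V) (T : Set V) : Prop where
  adj : G.Adj a b
  notMem : a ∉ T
  mem : b ∈ T
  eq : ∀ u w, u ∉ T → w ∈ T → G.Adj u w → u = a ∧ w = b

theorem IsCut.compl {a b : V} {T : Set V} (h : IsCut G a b T) : IsCut G b a Tᶜ where
  adj := h.adj.symm
  notMem := fun h' => h' h.mem
  mem := h.notMem
  eq u w hu hw hadj := (h.eq w u hw (not_not.1 hu) hadj.symm).symm

theorem isCut_of_not_reachable {u w : V} (huw : G.Adj u w)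
    (h : ¬ (G.deleteEdges {s(u, w)}).Reachable w u) :
    IsCut G u w {z | (G.deleteEdges {s(u, w)}).Reachable w z} where
  adj := huw
  notMem := h
  mem := Reachable.refl _
  eq x y hx hy hxy := by
    by_cases he : s(x, y) = s(u, w)
    · rcases Sym2.eq_iff.1 he with h' | ⟨rfl, rfl⟩
      · exact h'
      · exact absurd (Reachable.refl _) hx
    · exact absurd (Reachable.trans hy
        (Adj.reachable (deleteEdges_adj.2 ⟨hxy, he⟩)).symm) hx

theorem mem_of_adj_closed (hG : G.Connected) {S : Set V} {x : V} (hx : x ∈ S)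
    (hS : ∀ u ∈ S, ∀ w, G.Adj u w → w ∈ S) (y : V) : y ∈ S := by
  obtain ⟨p⟩ := hG.preconnected x y
  induction p with
  | nil => exact hx
  | cons h _ ih => exact ih (hS _ hx _ h)

/-- With both ends of the first bridge in `U`, no edge outside `U` crosses `T`. The only exit from
`Uᶜ` is at `c`, so whichever of `T \ U` and `Tᶜ \ U` misses `c` is closed under adjacency, hence
empty. -/
theorem IsCut.subset_or_compl_subset (hG : G.Connected) {a b c d : V} {T U : Set V}
    (hT : IsCut G a b T) (hU : IsCut G c d U) (ha : a ∈ U) (hb : b ∈ U) :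
    T ⊆ U ∨ Tᶜ ⊆ U := by
  by_contra! h
  obtain ⟨h₁, h₂⟩ := h
  obtain ⟨x, hxT, hxU⟩ := Set.not_subset.1 h₁
  obtain ⟨y, hyT, hyU⟩ := Set.not_subset.1 h₂
  have hstay : ∀ z z', z ∉ U → z' ∉ U → G.Adj z z' → (z ∈ T ↔ z' ∈ T) := by
    intro z z' hz hz' hadj
    by_cases h : z ∈ T <;> by_cases h' : z' ∈ T <;> simp only [h, h', iff_self]
    · exact (hz ((hT.eq _ _ h' h hadj.symm).2 ▸ hb)).elim
    · exact (hz ((hT.eq _ _ h h' hadj).1 ▸ ha)).elim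
  have hcT : c ∈ T := by
    by_contra hc
    have := mem_of_adj_closed hG (S := T \ U) (x := x) ⟨hxT, hxU⟩ (fun z hz w hzw => by
      have hw : w ∉ U := fun hw => hc ((hU.eq _ _ hz.2 hw hzw).1 ▸ hz.1)
      exact ⟨(hstay z w hz.2 hw hzw).1 hz.1, hw⟩) a
    exact this.2 ha
  have := mem_of_adj_closed hG (S := Tᶜ \ U) (x := y) ⟨hyT, hyU⟩ (fun z hz w hzw => by
    have hw : w ∉ U := fun hw => hz.1 ((hU.eq _ _ hz.2 hw hzw).1 ▸ hcT)
    exact ⟨fun hwT => hz.1 ((hstay z w hz.2 hw hzw).2 hwT), hw⟩) a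
  exact this.2 ha

theorem IsCut.subset_of_same_edge (hG : G.Connected) {a b : V} {T U : Set V}
    (hT : IsCut G a b T) (hU : IsCut G a b U) : T ⊆ U := by
  intro x hx
  by_contra hxU
  have := mem_of_adj_closed hG (S := T \ U) (x := x) ⟨hx, hxU⟩ (fun z hz w hzw => by
    refine ⟨?_, ?_⟩
    · by_contra hw
      exact hz.2 ((hT.eq _ _ hw hz.1 hzw.symm).2 ▸ hU.mem)
    · intro hw
      exact hT.notMem ((hU.eq _ _ hz.2 hw hzw).1 ▸ hz.1)) b
  exact this.2 hU.mem

/-- Bridge cuts do not cross. -/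
theorem IsCut.laminar (hG : G.Connected) {a b c d : V} {T U : Set V}
    (hT : IsCut G a b T) (hU : IsCut G c d U) :
    T ⊆ U ∨ Tᶜ ⊆ U ∨ T ⊆ Uᶜ ∨ Tᶜ ⊆ Uᶜ := by
  by_cases ha : a ∈ U <;> by_cases hb : b ∈ U
  · rcases hT.subset_or_compl_subset hG hU ha hb with h | h <;> simp [h]
  · obtain ⟨rfl, rfl⟩ := hU.eq _ _ hb ha hT.adj.symm
    exact Or.inr (Or.inr (Or.inl (hT.subset_of_same_edge hG hU.compl)))
  · obtain ⟨rfl, rfl⟩ := hU.eq _ _ ha hb hT.adj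
    exact Or.inl (hT.subset_of_same_edge hG hU)
  · rcases hT.subset_or_compl_subset hG hU.compl ha hb with h | h <;> simp [h]

/-- There are three pairwise disjoint bridge cuts. -/
def HasThreeCuts (G : SimpleGraph V) : Prop :=
  ∃ a b c a' b' c' T₁ T₂ T₃, IsCut G a a' T₁ ∧ IsCut G b b' T₂ ∧ IsCut G c c' T₃ ∧
    Disjoint T₁ T₂ ∧ Disjoint T₁ T₃ ∧ Disjoint T₂ T₃

/-- Among the laminar configurations, `T` and `U` cannot cover everything because `S` omits `e`, and
if they were disjoint, `Sᶜ` would be a third disjoint side. -/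
theorem IsCut.nested_of_subset (hG : G.Connected) (h3 : ¬ HasThreeCuts G) {a b c d e f : V}
    {T U S : Set V} (hT : IsCut G a b T) (hU : IsCut G c d U) (hS : IsCut G e f S)
    (hTS : T ⊆ S) (hUS : U ⊆ S) : T ⊆ U ∨ U ⊆ T := by
  rcases hT.laminar hG hU with h | h | h | h
  · exact Or.inl h
  · exact absurd (by_cases (fun ht : e ∈ T => hTS ht) (fun ht => hUS (h ht))) hS.notMem
  · exact (h3 ⟨_, _, _, _, _, _, _, _, _, hT, hU, hS.compl, Set.disjoint_left.2 fun x hx => h hx,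
      Set.disjoint_left.2 fun x hx hx' => hx' (hTS hx),
      Set.disjoint_left.2 fun x hx hx' => hx' (hUS hx)⟩).elim
  · exact Or.inr (Set.compl_subset_compl.1 h)

/-- Makes the cuts comparable with a fixed `S` a chain, which gives the bridges a common direction.
-/
theorem IsCut.nested_of_comparable (hG : G.Connected) (h3 : ¬ HasThreeCuts G) {a b c d e f : V}
    {T U S : Set V} (hT : IsCut G a b T) (hU : IsCut G c d U) (hS : IsCut G e f S)
    (hTS : T ⊆ S ∨ S ⊆ T) (hUS : U ⊆ S ∨ S ⊆ U) : T ⊆ U ∨ U ⊆ T := by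
  rcases hTS with hTS | hTS <;> rcases hUS with hUS | hUS
  · exact hT.nested_of_subset hG h3 hU hS hTS hUS
  · exact Or.inl (hTS.trans hUS)
  · exact Or.inr (hUS.trans hTS)
  · have := hT.compl.nested_of_subset hG h3 hU.compl hS.compl (Set.compl_subset_compl.2 hTS)
      (Set.compl_subset_compl.2 hUS)
    simpa only [Set.compl_subset_compl, or_comm] using this

/-- The directed walk back from `b` to `a` would have to use the same bridge in reverse. -/
theorem IsCyclicOrientation.not_arc_of_isCut {D : V → V → Prop} (hD : IsCyclicOrientation G D)
    {a b : V} {T : Set V} (hT : IsCut G a b T) : ¬ D a b := by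
  intro h
  have key : ∀ z, ReflTransGen D b z → z ∈ T := by
    intro z hz
    induction hz with
    | refl => exact hT.mem
    | @tail y z _ hyz ih =>
      by_contra hz'
      obtain ⟨rfl, rfl⟩ := hT.eq _ _ hz' ih (hD.adj _ _ hyz).symm
      exact hD.asymm _ _ h hyz
  exact hT.notMem (key _ (hD.back _ _ h))

/-- A connected graph without three pairwise disjoint bridge cuts has a unilaterally connected
(partial) orientation. -/
theorem exists_unilateral_orientation [Finite V] (hG : G.Connected) (h3 : ¬ HasThreeCuts G) :
    ∃ D : V → V → Prop, (∀ u v, D u v → G.Adj u v) ∧ (∀ u v, D u v → ¬ D v u) ∧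
      ∀ x y, ReflTransGen D x y ∨ ReflTransGen D y x := by
  obtain ⟨D, hD, hbridge⟩ := exists_cyclicOrientation G
  by_cases hcut : ∃ a b S, IsCut G a b S
  swap
  · refine ⟨D, hD.adj, hD.asymm, fun x y => Or.inl ?_⟩
    refine mem_of_adj_closed hG (S := {z | ReflTransGen D x z}) ReflTransGen.refl
      (fun u hu w huw => ?_) y
    by_contra hw
    exact hcut ⟨u, w, _, isCut_of_not_reachable huw
      (hbridge u w huw fun h => hw (ReflTransGen.trans hu h))⟩
  obtain ⟨e, f, S, hS⟩ := hcut
  let D' : V → V → Prop := fun u w => D u w ∨ ∃ T, IsCut G u w T ∧ (T ⊆ S ∨ S ⊆ T)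
  have hadj : ∀ u v, D' u v → G.Adj u v := by
    rintro u v (h | ⟨T, hT, -⟩)
    · exact hD.adj _ _ h
    · exact hT.adj
  have hasymm : ∀ u v, D' u v → ¬ D' v u := by
    rintro u v (h | ⟨T, hT, hTS⟩) (h' | ⟨U, hU, hUS⟩)
    · exact hD.asymm _ _ h h'
    · exact hD.not_arc_of_isCut hU.compl h
    · exact hD.not_arc_of_isCut hT.compl h'
    · rcases hT.nested_of_comparable hG h3 hU hS hTS hUS with h | h
      · exact hU.notMem (h hT.mem)
      · exact hT.notMem (h hU.mem)
  have hreach : ∀ x y, (∀ a b T, IsCut G a b T → (T ⊆ S ∨ S ⊆ T) → x ∈ T → y ∈ T) →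
      ReflTransGen D' x y := by
    intro x y hxy
    by_contra hy
    -- An edge leaving the set reachable from `x` is a bridge directed inwards. Its near side is in
    -- the chain and contains `x`, hence `y`.
    have hexit : ∀ u w, ReflTransGen D' x u → ¬ ReflTransGen D' x w → G.Adj u w →
        ∃ T, IsCut G w u T ∧ (T ⊆ S ∨ S ⊆ T) ∧ y ∈ T := by
      intro u w hu hw huw
      have hT := isCut_of_not_reachable huw (hbridge u w huw fun h =>
        hw (hu.trans (ReflTransGen.mono (fun _ _ => Or.inl) _ _ h)))
      set T := {z | (G.deleteEdges {s(u, w)}).Reachable w z}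
      have hTS : Tᶜ ⊆ S ∨ S ⊆ Tᶜ := by
        by_contra! hc
        have : ¬ (T ⊆ S ∨ S ⊆ T) := fun h => hw (hu.tail (Or.inr ⟨T, hT, h⟩))
        rcases hT.laminar hG hS with h | h | h | h
        · exact this (Or.inl h)
        · exact hc.1 h
        · exact hc.2 (Set.subset_compl_comm.1 h)
        · exact this (Or.inr (Set.compl_subset_compl.1 h))
      refine ⟨Tᶜ, hT.compl, hTS, hxy _ _ _ hT.compl hTS ?_⟩
      intro hx
      have key : ∀ z, ReflTransGen D' x z → z ∈ T := by
        intro z hz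
        induction hz with
        | refl => exact hx
        | @tail y z hxy hyz ih =>
          by_contra hz'
          obtain ⟨rfl, rfl⟩ := hT.eq _ _ hz' ih (hadj _ _ hyz).symm
          exact hw hxy
      exact hT.notMem (key u hu)
    -- A walk from `y` cannot enter the reachable set: it would have to come from the far side of an
    -- exit bridge, while `y` is on the near side.
    have := mem_of_adj_closed hG (S := {z | ¬ ReflTransGen D' x z ∧
      ∀ u w T, ReflTransGen D' x u → IsCut G w u T → y ∈ T → z ∈ T}) (x := y)
      ⟨hy, fun _ _ _ _ _ h => h⟩ (fun z hz z' hzz' => by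
        have hz' : ¬ ReflTransGen D' x z' := by
          intro hz'
          obtain ⟨T, hT, -, hyT⟩ := hexit z' z hz' hz.1 hzz'.symm
          exact hT.notMem (hz.2 _ _ _ hz' hT hyT)
        refine ⟨hz', fun u w T hu hT hyT => ?_⟩
        by_contra hzT
        have := (hT.eq _ _ hzT (hz.2 _ _ _ hu hT hyT) hzz'.symm).2
        exact hz.1 (this ▸ hu)) x
    exact this.1 .refl
  refine ⟨D', hadj, hasymm, fun x y => ?_⟩
  by_cases hxy : ∀ a b T, IsCut G a b T → (T ⊆ S ∨ S ⊆ T) → x ∈ T → y ∈ T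
  · exact Or.inl (hreach x y hxy)
  · push Not at hxy
    obtain ⟨a, b, T, hT, hTS, hx, hy⟩ := hxy
    refine Or.inr (hreach y x fun c d U hU hUS hyU => ?_)
    rcases hT.nested_of_comparable hG h3 hU hS hTS hUS with h | h
    · exact h hx
    · exact absurd (h hyU) hy

end Orientation

end ProperConnection

namespace ProperConnection

open Relation SimpleGraph

/-! ### The degree condition excludes three disjoint sides -/

section Degrees

variable {V : Type u} {G : SimpleGraph V}

/-- Otherwise `T` and `U` are the two sides of one bridge and exhaust the graph, leaving no room for
`S`. -/
theorem IsCut.not_mem_of_disjoint (hG : G.Connected) {a b c d e f : V} {T U S : Set V}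
    (hT : IsCut G a b T) (hU : IsCut G c d U) (hS : IsCut G e f S)
    (hTU : Disjoint T U) (hTS : Disjoint T S) (hUS : Disjoint U S) : a ∉ U := by
  intro ha
  have hb : b ∉ U := Set.disjoint_left.1 hTU hT.mem
  obtain ⟨rfl, rfl⟩ := hU.eq _ _ hb ha hT.adj.symm
  have := mem_of_adj_closed hG (S := T ∪ U) (x := b) (Or.inl hT.mem) (fun z hz w hzw => by
    rcases hz with hz | hz
    · by_cases hw : w ∈ T
      · exact Or.inl hw
      · exact Or.inr ((hT.eq _ _ hw hz hzw.symm).1 ▸ ha)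
    · by_cases hw : w ∈ U
      · exact Or.inr hw
      · exact Or.inl ((hU.eq _ _ hw hz hzw.symm).1 ▸ hT.mem)) f
  rcases this with h | h
  · exact Set.disjoint_left.1 hTS h hS.mem
  · exact Set.disjoint_left.1 hUS h hS.mem

theorem IsCut.mem_of_adj {a b : V} {T : Set V} (hT : IsCut G a b T) {p z : V} (hp : p ∈ T)
    (hpb : p ≠ b) (h : G.Adj p z) : z ∈ T := by
  by_contra hz
  exact hpb (hT.eq _ _ hz hp h.symm).2

variable [Fintype V] [DecidableRel G.Adj]

theorem degree_add_degree_le_card (hB : G.IsBipartite) {p q : V} (hpq : G.Adj p q)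
    {T : Finset V} (hp : ∀ z, G.Adj p z → z ∈ T) (hq : ∀ z, G.Adj q z → z ∈ T) :
    G.degree p + G.degree q ≤ T.card := by
  classical
  obtain ⟨col⟩ := hB
  rw [← card_neighborFinset_eq_degree, ← card_neighborFinset_eq_degree,
    ← Finset.card_union_of_disjoint]
  · refine Finset.card_le_card fun z hz => ?_
    rw [Finset.mem_union, mem_neighborFinset, mem_neighborFinset] at hz
    exact hz.elim (hp z) (hq z)
  · rw [Finset.disjoint_left]
    intro z hz hz'
    rw [mem_neighborFinset] at hz hz'
    have h₁ := col.valid hz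
    have h₂ := col.valid hz'
    have h₃ := col.valid hpq
    grind

/-- A side of a bridge contains a pendant vertex or an edge away from the bridge. -/
theorem IsCut.exists_pendant_or_edge (hG : G.Connected) {a b : V} {T : Set V}
    (hT : IsCut G a b T) :
    (∃ x ∈ T, G.degree x = 1) ∨ ∃ p ∈ T, ∃ q ∈ T, p ≠ b ∧ q ≠ b ∧ G.Adj p q := by
  have : Nontrivial V := ⟨a, b, hT.adj.ne⟩
  by_cases h : ∃ x ∈ T, x ≠ b
  · obtain ⟨x, hx, hxb⟩ := h
    by_cases hq : ∃ q, q ≠ b ∧ G.Adj x q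
    · obtain ⟨q, hqb, hxq⟩ := hq
      exact Or.inr ⟨x, hx, q, hT.mem_of_adj hx hxb hxq, hxb, hqb, hxq⟩
    · push Not at hq
      refine Or.inl ⟨x, hx, le_antisymm ?_ (hG.preconnected.degree_pos_of_nontrivial x)⟩
      rw [← card_neighborFinset_eq_degree]
      refine (Finset.card_le_card (t := {b}) fun z hz => ?_).trans (by simp)
      rw [mem_neighborFinset] at hz
      by_contra hzb
      exact hq z (by simpa using hzb) hz
  · push Not at h
    refine Or.inl ⟨b, hT.mem, le_antisymm ?_ (hG.preconnected.degree_pos_of_nontrivial b)⟩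
    rw [← card_neighborFinset_eq_degree]
    refine (Finset.card_le_card (t := {a}) fun z hz => ?_).trans (by simp)
    rw [mem_neighborFinset] at hz
    have hzT : z ∉ T := fun hz' => hz.ne (h z hz').symm
    simpa using (hT.eq _ _ hzT hT.mem hz.symm).1

/-- The degree sum condition excludes three pairwise disjoint bridge cuts. -/
theorem not_hasThreeCuts_of_degree_sum (hG : G.Connected) (hB : G.IsBipartite)
    (hcard : 4 ≤ Fintype.card V)
    (hdeg : ∀ x y : V, x ≠ y → ¬ G.Adj x y →
      Fintype.card V + 6 ≤ 4 * (G.degree x + G.degree y)) : ¬ HasThreeCuts G := by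
  classical
  rintro ⟨a, b, c, a', b', c', T₁, T₂, T₃, h₁, h₂, h₃, h₁₂, h₁₃, h₂₃⟩
  have hfar : ∀ {e e' f f' g g' : V} {T U S : Set V}, IsCut G e e' T → IsCut G f f' U →
      IsCut G g g' S → Disjoint T U → Disjoint T S → Disjoint U S → ∀ x ∈ T, ∀ y ∈ U,
      Fintype.card V + 6 ≤ 4 * (G.degree x + G.degree y) := by
    intro e e' f f' g g' T U S hT hU hS hTU hTS hUS x hx y hy
    have hyT := Set.disjoint_right.1 hTU hy
    refine hdeg x y (fun h => hyT (h ▸ hx)) fun hadj => ?_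
    exact hT.not_mem_of_disjoint hG hU hS hTU hTS hUS ((hT.eq _ _ hyT hx hadj.symm).1 ▸ hy)
  have f₁₂ := hfar h₁ h₂ h₃ h₁₂ h₁₃ h₂₃
  have f₁₃ := hfar h₁ h₃ h₂ h₁₃ h₁₂ h₂₃.symm
  have f₂₃ := hfar h₂ h₃ h₁ h₂₃ h₁₂.symm h₁₃.symm
  have ha₂ := h₁.not_mem_of_disjoint hG h₂ h₃ h₁₂ h₁₃ h₂₃
  have ha₃ := h₁.not_mem_of_disjoint hG h₃ h₂ h₁₃ h₁₂ h₂₃.symm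
  let C : Finset V := Finset.univ.filter fun z => z ∉ T₁ ∧ z ∉ T₂ ∧ z ∉ T₃
  have haC : a ∈ C := by simp [C, h₁.notMem, ha₂, ha₃]
  have hcards : T₁.toFinset.card + T₂.toFinset.card + T₃.toFinset.card + C.card =
      Fintype.card V := by
    rw [← Finset.card_univ, ← Finset.card_union_of_disjoint, ← Finset.card_union_of_disjoint,
      ← Finset.card_union_of_disjoint]
    · congr 1
      ext z
      simp only [C, Finset.mem_union, Set.mem_toFinset, Finset.mem_filter, Finset.mem_univ,
        true_and, iff_true]
      tauto
    · rw [Finset.disjoint_left]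
      simp only [C, Finset.mem_union, Set.mem_toFinset, Finset.mem_filter, Finset.mem_univ,
        true_and]
      tauto
    · rw [Finset.disjoint_left]
      simp only [Finset.mem_union, Set.mem_toFinset]
      rintro z (hz | hz)
      exacts [Set.disjoint_left.1 h₁₃ hz, Set.disjoint_left.1 h₂₃ hz]
    · simpa using h₁₂
  have hpos : ∀ {T : Set V} {x : V}, x ∈ T → 1 ≤ T.toFinset.card := fun hx =>
    Finset.card_pos.2 ⟨_, Set.mem_toFinset.2 hx⟩
  have hT₁ := hpos h₁.mem
  have hT₂ := hpos h₂.mem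
  have hT₃ := hpos h₃.mem
  have hC : 1 ≤ C.card := Finset.card_pos.2 ⟨a, haC⟩
  have hsize : ∀ {e e' p q : V} {T : Set V}, IsCut G e e' T → p ∈ T → q ∈ T → p ≠ e' → q ≠ e' →
      G.Adj p q → G.degree p + G.degree q ≤ T.toFinset.card := by
    intro e e' p q T hT hp hq hpe hqe hpq
    exact degree_add_degree_le_card hB hpq
      (fun z hz => Set.mem_toFinset.2 (hT.mem_of_adj hp hpe hz))
      (fun z hz => Set.mem_toFinset.2 (hT.mem_of_adj hq hqe hz))
  -- Let `n` be the order. Two pendant vertices on different sides have degree sum 2, too small. If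
  -- one side has a pendant vertex and the other two have inner edges, each of those two has at
  -- least `(n + 2) / 2` vertices.
  rcases h₁.exists_pendant_or_edge hG with ⟨x₁, hx₁, d₁⟩ | ⟨p₁, hp₁, q₁, hq₁, hpb₁, hqb₁, hpq₁⟩ <;>
  rcases h₂.exists_pendant_or_edge hG with ⟨x₂, hx₂, d₂⟩ | ⟨p₂, hp₂, q₂, hq₂, hpb₂, hqb₂, hpq₂⟩
  · have := f₁₂ _ hx₁ _ hx₂
    omega
  · rcases h₃.exists_pendant_or_edge hG with
      ⟨x₃, hx₃, d₃⟩ | ⟨p₃, hp₃, q₃, hq₃, hpb₃, hqb₃, hpq₃⟩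
    · have := f₁₃ _ hx₁ _ hx₃
      omega
    · have s₂ := hsize h₂ hp₂ hq₂ hpb₂ hqb₂ hpq₂
      have s₃ := hsize h₃ hp₃ hq₃ hpb₃ hqb₃ hpq₃
      have e₁ := f₁₂ _ hx₁ _ hp₂
      have e₂ := f₁₂ _ hx₁ _ hq₂
      have e₃ := f₁₃ _ hx₁ _ hp₃
      have e₄ := f₁₃ _ hx₁ _ hq₃
      omega
  · rcases h₃.exists_pendant_or_edge hG with
      ⟨x₃, hx₃, d₃⟩ | ⟨p₃, hp₃, q₃, hq₃, hpb₃, hqb₃, hpq₃⟩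
    · have := f₂₃ _ hx₂ _ hx₃
      omega
    · have s₁ := hsize h₁ hp₁ hq₁ hpb₁ hqb₁ hpq₁
      have s₃ := hsize h₃ hp₃ hq₃ hpb₃ hqb₃ hpq₃
      have e₁ := f₁₂ _ hp₁ _ hx₂
      have e₂ := f₁₂ _ hq₁ _ hx₂
      have e₃ := f₂₃ _ hx₂ _ hp₃
      have e₄ := f₂₃ _ hx₂ _ hq₃
      omega
  · have s₁ := hsize h₁ hp₁ hq₁ hpb₁ hqb₁ hpq₁
    have s₂ := hsize h₂ hp₂ hq₂ hpb₂ hqb₂ hpq₂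
    rcases h₃.exists_pendant_or_edge hG with
      ⟨x₃, hx₃, d₃⟩ | ⟨p₃, hp₃, q₃, hq₃, hpb₃, hqb₃, hpq₃⟩
    · have e₁ := f₁₃ _ hp₁ _ hx₃
      have e₂ := f₁₃ _ hq₁ _ hx₃
      have e₃ := f₂₃ _ hp₂ _ hx₃
      have e₄ := f₂₃ _ hq₂ _ hx₃
      omega
    -- Without pendant vertices, the sides together have at least `3(n + 6) / 4` vertices. Hence
    -- `4|C| ≤ n - 18`, and `n ≥ 22` as `C` contains `a`.
    have s₃ := hsize h₃ hp₃ hq₃ hpb₃ hqb₃ hpq₃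
    have e₁ := f₁₂ _ hp₁ _ hp₂
    have e₂ := f₁₂ _ hq₁ _ hq₂
    have e₃ := f₁₃ _ hp₁ _ hp₃
    have e₄ := f₁₃ _ hq₁ _ hq₃
    have e₅ := f₂₃ _ hp₂ _ hp₃
    have e₆ := f₂₃ _ hq₂ _ hq₃
    have hmid : ∀ {e e' p x : V} {T : Set V}, IsCut G e e' T → p ∈ T → p ≠ e' → x ∉ T →
        Fintype.card V + 6 ≤ 4 * (G.degree x + G.degree p) := by
      intro e e' p x T hT hp hpe hx
      exact hdeg x p (fun h => hx (h ▸ hp)) fun hadj => hx (hT.mem_of_adj hp hpe hadj.symm)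
    have hnbr : ∀ x ∈ C, ∀ z, G.Adj x z → z ∈ C ∨ z ∈ ({a', b', c'} : Finset V) := by
      intro x hx z hxz
      simp only [C, Finset.mem_filter, Finset.mem_univ, true_and] at hx
      by_cases z₁ : z ∈ T₁
      · simp [(h₁.eq _ _ hx.1 z₁ hxz).2]
      by_cases z₂ : z ∈ T₂
      · simp [(h₂.eq _ _ hx.2.1 z₂ hxz).2]
      by_cases z₃ : z ∈ T₃
      · simp [(h₃.eq _ _ hx.2.2 z₃ hxz).2]
      exact Or.inl (by simp [C, z₁, z₂, z₃])
    have hthree : ({a', b', c'} : Finset V).card ≤ 3 := Finset.card_le_three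
    have a₁ := hmid h₁ hp₁ hpb₁ h₁.notMem
    have a₂ := hmid h₁ hq₁ hqb₁ h₁.notMem
    have a₃ := hmid h₂ hp₂ hpb₂ ha₂
    have a₄ := hmid h₂ hq₂ hqb₂ ha₂
    have a₅ := hmid h₃ hp₃ hpb₃ ha₃
    have a₆ := hmid h₃ hq₃ hqb₃ ha₃
    -- A neighbour of `a` in `C` gives an edge of degree sum at most `|C| + 3`, which forces `4|C| ≥
    -- n`. Otherwise `a` has degree at most 3, which forces `n ≤ 16`.
    by_cases hx : ∃ x ∈ C, G.Adj a x
    · obtain ⟨x, hxC, hax⟩ := hx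
      have hle := degree_add_degree_le_card hB hax (T := C ∪ {a', b', c'})
        (fun z hz => Finset.mem_union.2 (hnbr a haC z hz))
        (fun z hz => Finset.mem_union.2 (hnbr x hxC z hz))
      have hle' := hle.trans (Finset.card_union_le _ _)
      simp only [C, Finset.mem_filter, Finset.mem_univ, true_and] at hxC
      have x₁ := hmid h₁ hp₁ hpb₁ hxC.1
      have x₂ := hmid h₁ hq₁ hqb₁ hxC.1
      have x₃ := hmid h₂ hp₂ hpb₂ hxC.2.1
      have x₄ := hmid h₂ hq₂ hqb₂ hxC.2.1
      have x₅ := hmid h₃ hp₃ hpb₃ hxC.2.2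
      have x₆ := hmid h₃ hq₃ hqb₃ hxC.2.2
      omega
    · have hda : G.degree a ≤ 3 := by
        rw [← card_neighborFinset_eq_degree]
        refine (Finset.card_le_card fun z hz => ?_).trans hthree
        rw [mem_neighborFinset] at hz
        exact (hnbr a haC z hz).resolve_left fun h => hx ⟨z, h, hz⟩
      omega

end Degrees

end ProperConnection

namespace ProperConnection

open Relation SimpleGraph

/-! ### From orientations to proper colourings with two colours -/

section Colouring

variable {V : Type u} {G : SimpleGraph V}

theorem exists_walk_of_reflTransGen {D : V → V → Prop} (hD : ∀ u v, D u v → G.Adj u v) {x y : V}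
    (h : ReflTransGen D x y) : ∃ p : G.Walk x y, ∀ d ∈ p.darts, D d.fst d.snd := by
  induction h using ReflTransGen.head_induction_on with
  | refl => exact ⟨.nil, by simp⟩
  | head h _ ih =>
    obtain ⟨p, hp⟩ := ih
    exact ⟨.cons (hD _ _ h) p, by simpa [h] using hp⟩

theorem IsProperPath.reverse {α : Type} {c : G.edgeSet → α} {x y : V} {p : G.Walk x y}
    (hp : IsProperPath c p) : IsProperPath c p.reverse := by
  refine ⟨hp.1.reverse, ?_⟩
  have : (p.reverse.darts.map fun d => c ⟨d.edge, d.edge_mem⟩) =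
      (p.darts.map fun d => c ⟨d.edge, d.edge_mem⟩).reverse := by
    simp [Walk.darts_reverse, Function.comp_def]
  rw [this, List.isChain_reverse]
  exact hp.2.imp fun _ _ h => h.symm

/-- A unilaterally connected orientation of a bipartite graph gives a proper connected colouring
with two colours: an edge is coloured by the part its tail lies in. -/
theorem exists_isProperConnected_of_orientation (hB : G.IsBipartite) {D : V → V → Prop}
    (hadj : ∀ u v, D u v → G.Adj u v) (hasymm : ∀ u v, D u v → ¬ D v u)
    (huni : ∀ x y, ReflTransGen D x y ∨ ReflTransGen D y x) :
    ∃ c : G.edgeSet → Fin 2, IsProperConnected G c := by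
  classical
  obtain ⟨col⟩ := hB
  let c : G.edgeSet → Fin 2 := fun e =>
    -- Unoriented edges also get colour 1, harmlessly: the paths below use arcs only.
    if ∃ u v, e.1 = s(u, v) ∧ D u v ∧ col u = 0 then 0 else 1
  have hc : ∀ d : G.Dart, D d.fst d.snd → c ⟨d.edge, d.edge_mem⟩ = col d.fst := by
    intro d hd
    by_cases h0 : col d.fst = 0
    · rw [h0]
      exact if_pos ⟨d.fst, d.snd, rfl, hd, h0⟩
    · have h1 : col d.fst = 1 := by omega
      rw [h1]
      refine if_neg ?_
      rintro ⟨u, v, he, huv, hu⟩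
      rcases Sym2.eq_iff.1 (show s(d.fst, d.snd) = s(u, v) from he) with ⟨rfl, rfl⟩ | ⟨rfl, rfl⟩
      · exact h0 hu
      · exact hasymm _ _ hd huv
  have hpath : ∀ x y, ReflTransGen D x y → ∃ p : G.Walk x y, IsProperPath c p := by
    intro x y h
    obtain ⟨p, hp⟩ := exists_walk_of_reflTransGen hadj h
    refine ⟨p.bypass, p.bypass_isPath, ?_⟩
    have hp' : ∀ d ∈ p.bypass.darts, D d.fst d.snd := fun d hd =>
      hp d (p.darts_bypass_subset_darts hd)
    rw [List.map_congr_left fun d hd => hc d (hp' d hd), List.isChain_map]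
    refine (Walk.isChain_dartAdj_darts _).imp fun d d' hdd' => ?_
    rw [← show d.snd = d'.fst from hdd']
    exact col.valid d.adj
  refine ⟨c, fun x y _ => ?_⟩
  rcases huni x y with h | h
  · exact hpath x y h
  · obtain ⟨p, hp⟩ := hpath y x h
    exact ⟨p.reverse, hp.reverse⟩

/-- With at most one colour, proper paths have at most one edge. -/
theorem IsProperPath.adj_of_subsingleton {α : Type} [Subsingleton α] {c : G.edgeSet → α} {x y : V}
    {p : G.Walk x y} (hp : IsProperPath c p) (hne : x ≠ y) : G.Adj x y := by
  obtain ⟨-, hc⟩ := hp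
  match p, hc with
  | .nil, _ => exact absurd rfl hne
  | .cons h .nil, _ => exact h
  | .cons h (.cons h' q), hc =>
    simp only [Walk.darts_cons, List.map_cons, List.isChain_cons_cons] at hc
    exact absurd (Subsingleton.elim _ _) hc.1

/-- The colouring `c` ensures that the infimum is not the default value 0 of an empty set. -/
theorem two_le_pc {n : ℕ} {c : G.edgeSet → Fin n} (hc : IsProperConnected G c) {x y : V}
    (hne : x ≠ y) (hxy : ¬ G.Adj x y) : 2 ≤ pc G := by
  refine le_csInf ⟨n, c, hc⟩ ?_
  rintro k ⟨c', hc'⟩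
  by_contra! hk
  have : Subsingleton (Fin k) := Fin.subsingleton_iff_le_one.2 (by omega)
  obtain ⟨p, hp⟩ := hc' x y hne
  exact hxy (hp.adj_of_subsingleton hne)

theorem exists_not_adj_of_isBipartite [Fintype V] (hB : G.IsBipartite)
    (hcard : 2 < Fintype.card V) : ∃ x y, x ≠ y ∧ ¬ G.Adj x y := by
  obtain ⟨col⟩ := hB
  obtain ⟨x, y, hne, h⟩ := Fintype.exists_ne_map_eq_of_card_lt col (by simpa using hcard)
  exact ⟨x, y, hne, fun hadj => col.valid hadj h⟩

theorem pc_eq_two_of_degree_sum [Fintype V] [DecidableRel G.Adj] (hcard : 4 ≤ Fintype.card V)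
    (hG : G.Connected) (hB : G.IsBipartite)
    (hdeg : ∀ x y : V, x ≠ y → ¬ G.Adj x y →
      Fintype.card V + 6 ≤ 4 * (G.degree x + G.degree y)) : pc G = 2 := by
  obtain ⟨D, hadj, hasymm, huni⟩ :=
    exists_unilateral_orientation hG (not_hasThreeCuts_of_degree_sum hG hB hcard hdeg)
  obtain ⟨c, hc⟩ := exists_isProperConnected_of_orientation hB hadj hasymm huni
  obtain ⟨x, y, hne, hxy⟩ := exists_not_adj_of_isBipartite hB (by omega)
  exact le_antisymm (Nat.sInf_le ⟨c, hc⟩) (two_le_pc hc hne hxy)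

end Colouring

end ProperConnection

namespace ProperConnection

open Relation SimpleGraph

/-! ### The extremal example of order 19 -/

section Example

/-- Replaces walks by conditions on vertex lists that the kernel can decide. -/
theorem exists_isProperPath_of_list {V : Type u} {G : SimpleGraph V} {α : Type} (f : V → V → α)
    (c : G.edgeSet → α) (hc : ∀ d : G.Dart, c ⟨d.edge, d.edge_mem⟩ = f d.fst d.snd)
    {x y : V} (l : List V) (hadj : (x :: l).IsChain G.Adj) (hnodup : (x :: l).Nodup)
    (hlast : (x :: l).getLast (by simp) = y)
    (hcol : (List.zipWith f (x :: l) l).IsChain (· ≠ ·)) :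
    ∃ p : G.Walk x y, IsProperPath c p := by
  have key : ∀ (l : List V) (x : V), (x :: l).IsChain G.Adj →
      (x :: l).getLast (by simp) = y → ∃ p : G.Walk x y, p.support = x :: l ∧
        (p.darts.map fun d => c ⟨d.edge, d.edge_mem⟩) = List.zipWith f (x :: l) l := by
    intro l
    induction l with
    | nil =>
      rintro x - rfl
      exact ⟨.nil, by simp⟩
    | cons z l ih =>
      intro x hx hy
      rw [List.isChain_cons_cons] at hx
      obtain ⟨p, hp, hp'⟩ := ih z hx.2 (by simpa using hy)
      refine ⟨.cons hx.1 p, by simp [hp], ?_⟩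
      rw [Walk.darts_cons, List.map_cons, hp', List.zipWith_cons_cons, hc]
  obtain ⟨p, hp, hp'⟩ := key l x hadj hlast
  exact ⟨p, p.isPath_def.2 (hp ▸ hnodup), hp' ▸ hcol⟩

/-- The colour of an edge of `exampleGraph`: the bridge at the `i`-th copy gets colour `i`, the
edges of the copy get the two other colours, alternating along a Hamiltonian cycle. -/
def exampleColour :
    Option (Fin 3 × Bool × Fin 3) → Option (Fin 3 × Bool × Fin 3) → Fin 3
  | none, none => 0
  | none, some (i, _, _) => i
  | some (i, _, _), none => i
  | some (i, _, j), some (_, _, j') => if j = j' then i + 1 else i + 2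

theorem exampleColour_comm :
    ∀ x y, exampleGraph.Adj x y → exampleColour x y = exampleColour y x := by
  decide +kernel

/-- The vertices after `u` on the way to `v` along the Hamiltonian cycle of `K_{3,3}`. -/
def hamiltonArc : ℕ → Bool × Fin 3 → Bool × Fin 3 → List (Bool × Fin 3)
  | 0, _, _ => []
  | n + 1, u, v =>
    if u = v then [] else
      let u' : Bool × Fin 3 := if u.1 then (false, u.2 + 1) else (true, u.2)
      u' :: hamiltonArc n u' v

/-- The vertices after the first on a proper path of `exampleGraph`. -/
def exampleRoute :
    Option (Fin 3 × Bool × Fin 3) → Option (Fin 3 × Bool × Fin 3) →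
      List (Option (Fin 3 × Bool × Fin 3))
  | none, none => []
  | none, some (i, v) =>
    -- Five steps suffice on a Hamiltonian cycle of length 6.
    some (i, false, 0) :: (hamiltonArc 5 (false, 0) v).map fun w => some (i, w)
  | some (i, u), none => ((hamiltonArc 5 u (false, 0)).map fun w => some (i, w)) ++ [none]
  | some (i, u), some (j, v) =>
    if i = j then (hamiltonArc 5 u v).map fun w => some (i, w) else
      ((hamiltonArc 5 u (false, 0)).map fun w => some (i, w)) ++ none :: some (j, false, 0) ::
        (hamiltonArc 5 (false, 0) v).map fun w => some (j, w)

theorem exampleRoute_spec : ∀ x y,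
    (x :: exampleRoute x y).IsChain exampleGraph.Adj ∧ (x :: exampleRoute x y).Nodup ∧
      (x :: exampleRoute x y).getLast (by simp) = y ∧
      (List.zipWith exampleColour (x :: exampleRoute x y) (exampleRoute x y)).IsChain (· ≠ ·) := by
  decide +kernel

theorem exists_isProperConnected_exampleGraph :
    ∃ c : exampleGraph.edgeSet → Fin 3, IsProperConnected exampleGraph c := by
  have hends : ∀ e : exampleGraph.edgeSet, ∃ d : exampleGraph.Dart, d.edge = e.1 := by
    rintro ⟨e, he⟩
    induction e with
    | h x y => exact ⟨⟨(x, y), he⟩, rfl⟩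
  choose D hD using hends
  refine ⟨fun e => exampleColour (D e).fst (D e).snd, fun x y _ => ?_⟩
  obtain ⟨h₁, h₂, h₃, h₄⟩ := exampleRoute_spec x y
  refine exists_isProperPath_of_list exampleColour _ (fun d => ?_) _ h₁ h₂ h₃ h₄
  rcases (dart_edge_eq_iff _ _).1 (hD ⟨d.edge, d.edge_mem⟩) with h | h
  · rw [h]
  · rw [h]
    exact (exampleColour_comm _ _ d.adj).symm

theorem connected_exampleGraph : exampleGraph.Connected := by
  obtain ⟨c, hc⟩ := exists_isProperConnected_exampleGraph
  refine (connected_iff _).2 ⟨fun x y => ?_, inferInstance⟩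
  by_cases h : x = y
  · exact h ▸ Reachable.refl _
  · exact ⟨(hc x y h).choose⟩

theorem isBipartite_exampleGraph : exampleGraph.IsBipartite := by
  let col : Option (Fin 3 × Bool × Fin 3) → Fin 2
    | none => 1
    | some (_, b, _) => if b then 1 else 0
  have h : ∀ x y, exampleGraph.Adj x y → col x ≠ col y := by decide +kernel
  exact ⟨Coloring.mk col fun {x y} => h x y⟩

theorem three_le_degree_exampleGraph : ∀ x, 3 ≤ exampleGraph.degree x := by
  decide +kernel

theorem exampleGraph_walk_same_copy {i j : Fin 3} {u v : Bool × Fin 3}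
    (p : exampleGraph.Walk (some (i, u)) (some (j, v))) (hp : none ∉ p.support) : i = j := by
  have key : ∀ {x y} (p : exampleGraph.Walk x y), none ∉ p.support →
      x.map Prod.fst = y.map Prod.fst := by
    intro x y p
    induction p with
    | nil => simp
    | @cons x z y h p ih =>
      intro hp
      simp only [Walk.support_cons, List.mem_cons, not_or] at hp
      rw [← ih hp.2]
      match x, z, h with
      | none, _, _ => exact absurd rfl hp.1
      | some _, none, _ => exact absurd p.start_mem_support hp.2
      | some (i, _), some (i', _), h => exact congrArg some h.1
  simpa using key p hp

theorem exampleGraph_bridge (i : Fin 3) :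
    s(none, some (i, false, 0)) ∈ exampleGraph.edgeSet :=
  exampleGraph.mem_edgeSet.2 ⟨rfl, rfl⟩

/-- A proper path between two copies passes consecutively through two bridges. -/
theorem bridge_colours_ne {α : Type} {c : exampleGraph.edgeSet → α} {i j : Fin 3} (hij : i ≠ j)
    {u v : Bool × Fin 3} {p : exampleGraph.Walk (some (i, u)) (some (j, v))}
    (hp : IsProperPath c p) :
    c ⟨s(none, some (i, false, 0)), exampleGraph_bridge i⟩ ≠
      c ⟨s(none, some (j, false, 0)), exampleGraph_bridge j⟩ := by
  have key : ∀ {x y} (p : exampleGraph.Walk x y), x.map Prod.fst = some i →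
      y.map Prod.fst = some j → IsProperPath c p →
      c ⟨s(none, some (i, false, 0)), exampleGraph_bridge i⟩ ≠
        c ⟨s(none, some (j, false, 0)), exampleGraph_bridge j⟩ := by
    intro x y p
    induction p with
    | nil =>
      intro hx hy
      exact absurd (Option.some.inj (hx.symm.trans hy)) hij
    | @cons x z y h w ih =>
      intro hx hy hp
      obtain ⟨hpath, hcol⟩ := hp
      rw [Walk.cons_isPath_iff] at hpath
      rcases x with _ | ⟨i', b, k⟩
      · simp at hx
      obtain rfl : i' = i := by simpa using hx
      rcases z with _ | ⟨i'', u'⟩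
      · obtain ⟨rfl, rfl⟩ := h
        clear ih
        rcases y with _ | ⟨j', v'⟩
        · simp at hy
        obtain rfl : j' = j := by simpa using hy
        -- The path never returns to `none`, so its next vertex is already in copy `j` and its next
        -- edge is the bridge there.
        cases w with
        | @cons _ z _ h' q =>
          have hq := (Walk.cons_isPath_iff _ _).1 hpath.1
          rcases z with _ | ⟨i'', b', k'⟩
          · exact h'.elim
          obtain rfl := exampleGraph_walk_same_copy q hq.2
          obtain ⟨rfl, rfl⟩ := h'
          exact fun h => (List.isChain_cons_cons.1 hcol).1 ((congrArg c (Subtype.ext Sym2.eq_swap)).trans h)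
      · refine ih (congrArg some h.1.symm) hy ⟨hpath.1, ?_⟩
        exact hcol.tail
  exact key p rfl rfl hp

theorem pc_exampleGraph : pc exampleGraph = 3 := by
  obtain ⟨c, hc⟩ := exists_isProperConnected_exampleGraph
  refine le_antisymm (Nat.sInf_le ⟨c, hc⟩) (le_csInf ⟨3, c, hc⟩ ?_)
  rintro k ⟨c', hc'⟩
  by_contra! hk
  obtain ⟨i, j, hij, h⟩ := Fintype.exists_ne_map_eq_of_card_lt (fun i : Fin 3 =>
    c' ⟨s(none, some (i, false, 0)), exampleGraph_bridge i⟩) (by simpa using hk)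
  obtain ⟨p, hp⟩ := hc' (some (i, false, 0)) (some (j, false, 0)) (by simpa using hij)
  exact bridge_colours_ne hij hp h

theorem degree_sum_exampleGraph (x y : Option (Fin 3 × Bool × Fin 3)) :
    (6 : ℝ) ≤ (exampleGraph.degree x : ℝ) + (exampleGraph.degree y : ℝ) := by
  have hx := three_le_degree_exampleGraph x
  have hy := three_le_degree_exampleGraph y
  exact_mod_cast add_le_add hx hy

end Example

end ProperConnection

theorem theorem2 :
    -- the degree sum condition is sufficient
    (∀ (V : Type u) [Fintype V] (G : SimpleGraph V) [DecidableRel G.Adj],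
      4 ≤ Fintype.card V → G.Connected → G.IsBipartite →
      (∀ x y : V, x ≠ y → ¬ G.Adj x y →
        ((Fintype.card V : ℝ) + 6) / 4 ≤ (G.degree x : ℝ) + (G.degree y : ℝ)) →
      ProperConnection.pc G = 2) ∧
    -- the example, of order 19
    (Fintype.card (Option (Fin 3 × Bool × Fin 3)) = 19 ∧
      ProperConnection.exampleGraph.Connected ∧
      ProperConnection.exampleGraph.IsBipartite ∧
      (∀ x y, x ≠ y → ¬ ProperConnection.exampleGraph.Adj x y →
        (19 : ℝ) / 4 + 1 ≤ (ProperConnection.exampleGraph.degree x : ℝ) +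
          (ProperConnection.exampleGraph.degree y : ℝ)) ∧
      ProperConnection.pc ProperConnection.exampleGraph = 3) ∧
    -- the bound is best possible: `(n + 6) / 4` cannot be lowered to `(n + 5) / 4`
    ¬ (∀ (V : Type) [Fintype V] (G : SimpleGraph V) [DecidableRel G.Adj],
      4 ≤ Fintype.card V → G.Connected → G.IsBipartite →
      (∀ x y : V, x ≠ y → ¬ G.Adj x y →
        ((Fintype.card V : ℝ) + 5) / 4 ≤ (G.degree x : ℝ) + (G.degree y : ℝ)) →
      ProperConnection.pc G = 2) := by
  have hcard : Fintype.card (Option (Fin 3 × Bool × Fin 3)) = 19 := by decide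
  refine ⟨?_, ⟨hcard, ProperConnection.connected_exampleGraph,
    ProperConnection.isBipartite_exampleGraph, fun x y _ _ => ?_,
    ProperConnection.pc_exampleGraph⟩, fun h => ?_⟩
  · intro V _ G _ hV hG hB hdeg
    refine ProperConnection.pc_eq_two_of_degree_sum hV hG hB fun x y hne hxy => ?_
    have := hdeg x y hne hxy
    have h' : (Fintype.card V : ℝ) + 6 ≤ 4 * (G.degree x + G.degree y) := by linarith
    exact_mod_cast h'
  · have := ProperConnection.degree_sum_exampleGraph x y
    linarith
  -- The weakened bound is exactly `(19 + 5) / 4 = 6`, twice the minimum degree of the example.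
  · have h2 := h _ ProperConnection.exampleGraph (by rw [hcard]; norm_num)
      ProperConnection.connected_exampleGraph ProperConnection.isBipartite_exampleGraph
      fun x y _ _ => by
        have := ProperConnection.degree_sum_exampleGraph x y
        rw [hcard]
        norm_num
        linarith
    rw [ProperConnection.pc_exampleGraph] at h2
    omega
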